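/- All rings are commutative with identity. An integral domain $R$ is a \emph{finite factorization domain} (FFD) if every nonzero nonunit of $R$ is a finite product of irreducible elements and every nonzero nonunit of $R$ has only finitely many factorizations into irreducibles, up to order of the factors and associates. An \emph{overring} of $R$ is a subring of the quotient field $\mathrm{qf}(R)$ containing $R$, and $U(A)$ denotes the group of units of a ring $A$. Proposition. Let $R$ be a Noetherian integral domain. The following statements are equivalent. (a) $R$ is an FFD. (b) If $S$ is an overring of $R$ that is a finitely generated $R$-module, then the group $U(S)/U(R)$ is finite. (c) There is an overring $T$ of $R$ such that $T$ is an FFD, $T$ is integral over $R$, and for every intermediate ring $R \subseteq S \subseteq T$ that is a finitely generated $R$-module, the group $U(S)/U(R)$ is finite. -/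

import Mathlib

/-- An integral domain is atomic if every nonzero nonunit is a (finite, nonempty) product of
irreducible elements. -/
def IsAtomicDomain (R : Type*) [CommRing R] [IsDomain R] : Prop :=
  ∀ x : R, x ≠ 0 → ¬ IsUnit x → ∃ s : Multiset R, (∀ a ∈ s, Irreducible a) ∧ s.prod = x

/-- The factorizations of `x` into irreducibles, up to order and associates: finite multisets of
associate classes of irreducibles whose product is the associate class of `x`. -/
def factorizationClasses (R : Type*) [CommRing R] [IsDomain R] (x : R) :
    Set (Multiset (Associates R)) :=
  {z | (∀ a ∈ z, Irreducible a) ∧ z.prod = Associates.mk x}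

/-- A finite factorization domain: an atomic domain in which every nonzero nonunit factors into
irreducibles in only finitely many ways, up to order and associates. -/
structure IsFFD (R : Type*) [CommRing R] [IsDomain R] : Prop where
  atomic : IsAtomicDomain R
  finite_factorizations : ∀ x : R, x ≠ 0 → ¬ IsUnit x → (factorizationClasses R x).Finite

/-- The group `U(S) / U(R)` for an `R`-algebra `S`: the quotient of the unit group of `S` by the
image of the unit group of `R` (for an overring `S` of `R`, this image is a copy of `U(R)`). -/
abbrev UnitsQuotient (R S : Type*) [CommRing R] [CommRing S] [Algebra R S] : Type _ :=
  Sˣ ⧸ (Units.map (algebraMap R S : R →* S)).range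

/-! In a Noetherian domain, FFD means that every nonzero `x` has finitely many divisors up to
associates. If this holds and `c S ⊆ R` with `c ≠ 0`, then `u ↦ c u` sends units of `S` to divisors
of `c ^ 2`, and units in distinct classes modulo `U(R)` to non-associates, so `U(S)/U(R)` is finite.

Conversely, take infinitely many non-associated divisors of `x`, and suppose that their quotients
all lie in an integral overring `T`. The quotients by a fixed `y₀` lie in `R y₀⁻¹`, so they generate
a module-finite ring `S ⊆ T`, in which they are units; finiteness of `U(S)/U(R)` then makes two of
the divisors associated (`isFFD_of_exists_infinite_subset_div_mem`). An FFD `T` supplies such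
divisors by pigeonhole.

When `T` is the integral closure, they are supplied by `exists_infinite_subset_isIntegral_div`,
which would also follow from the Mori–Nagata theorem; the argument here is direct. The minimal
primes over `{s | s (y / z) integral}` are among the finitely many associated primes `P` of `x`.
Inside the integral closure of `R_P`, let `W` consist of the elements that a power of the maximal
ideal carries into `R_P`. This ring is Noetherian, and each associated prime of `x W` above `P` has
an element `τ` acting like the inverse of a uniformizer. The resulting orders of divisors of `x` are
bounded, so pigeonhole equalizes them on an infinite subset, and this forces `y / z` to be integral
at `P`. -/

/-! ### Integrality through polynomials modulo `r X - s` -/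

open Polynomial in
/-- A power of `r` reduces every polynomial to a constant modulo `r X - s`. -/
theorem exists_pow_mul_sub_C_dvd {O : Type*} [CommRing O] (r s : O) (h : O[X]) :
    ∃ (N : ℕ) (e : O), C r * X - C s ∣ C (r ^ N) * h - C e := by
  induction h using Polynomial.induction_on' with
  | add p q hp hq =>
    obtain ⟨M, d, u, hu⟩ := hp
    obtain ⟨N, e, v, hv⟩ := hq
    refine ⟨M + N, r ^ N * d + r ^ M * e, C (r ^ N) * u + C (r ^ M) * v, ?_⟩
    have h1 : C (r ^ M) * p = C d + (C r * X - C s) * u := by rw [← hu]; ring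
    have h2 : C (r ^ N) * q = C e + (C r * X - C s) * v := by rw [← hv]; ring
    calc _ = C (r ^ N) * (C (r ^ M) * p) + C (r ^ M) * (C (r ^ N) * q)
          - C (r ^ N * d + r ^ M * e) := by rw [pow_add, C_mul]; ring
      _ = _ := by rw [h1, h2]; simp only [C_add, C_mul]; ring
  | monomial n a =>
    refine ⟨n, a * s ^ n, ?_⟩
    have : C (r ^ n) * monomial n a - C (a * s ^ n) = C a * ((C r * X) ^ n - C s ^ n) := by
      rw [← C_mul_X_pow_eq_monomial]; simp only [C_mul, C_pow]; ring
    rw [this]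
    exact (sub_dvd_pow_sub_pow _ _ n).mul_left _

open Polynomial in
/-- If `w` is a root of `r X - s`, then one power of `r` carries every polynomial vanishing at `w`
into the ideal generated by `r X - s`. -/
theorem exists_pow_mul_dvd_of_aeval_eq_zero {O K : Type*} [CommRing O] [IsNoetherianRing O]
    [Field K] [Algebra O K] (hinj : Function.Injective (algebraMap O K)) {r s : O} {w : K}
    (hw : algebraMap O K r * w = algebraMap O K s) :
    ∃ N : ℕ, ∀ h : O[X], aeval w h = 0 → C r * X - C s ∣ C (r ^ N) * h := by
  -- The exponent for a single polynomial depends on its degree; the ascending chain of colon ideals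
  -- makes it uniform.
  let L : ℕ →o Ideal O[X] :=
    { toFun := fun n => (Ideal.span {C r * X - C s}).colon {C (r ^ n)}
      monotone' := by
        intro m n hmn h hh
        simp only [Submodule.mem_colon_singleton, smul_eq_mul, Ideal.mem_span_singleton] at hh ⊢
        obtain ⟨k, rfl⟩ := Nat.exists_eq_add_of_le hmn
        rw [pow_add, C_mul, ← mul_assoc]
        exact hh.mul_right _ }
  obtain ⟨N, hN⟩ := monotone_stabilizes_iff_noetherian.mpr inferInstance L
  refine ⟨N, fun h hh => ?_⟩
  obtain ⟨M, e, he⟩ := exists_pow_mul_sub_C_dvd r s h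
  have h0 : e = 0 := by
    obtain ⟨q, hq⟩ := he
    have := congrArg (aeval w) hq
    simp only [map_sub, map_mul, aeval_C, hh, aeval_X, hw, sub_self, mul_zero, zero_mul,
      zero_sub, neg_eq_zero] at this
    exact hinj (by simpa using this)
  subst h0
  have hM : h ∈ L (max M N) := by
    refine L.monotone (le_max_left M N) ?_
    change h ∈ (Ideal.span {C r * X - C s}).colon {C (r ^ M)}
    rw [Submodule.mem_colon_singleton, smul_eq_mul, Ideal.mem_span_singleton, mul_comm h]
    rwa [C_0, sub_zero] at he
  rw [← hN _ (le_max_right M N)] at hM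
  have hM' : h ∈ (Ideal.span {C r * X - C s}).colon {C (r ^ N)} := hM
  rwa [Submodule.mem_colon_singleton, smul_eq_mul, Ideal.mem_span_singleton, mul_comm h] at hM'

theorem pow_dvd_of_pow_dvd_pow_mul {O : Type*} [CommRing O] [IsDomain O] {x y : O} (hx : x ≠ 0)
    (hreg : ∀ r, x ∣ y * r → x ∣ r) (m k : ℕ) : ∀ r, x ^ k ∣ y ^ m * r → x ^ k ∣ r := by
  have hpow : ∀ m : ℕ, ∀ r, x ∣ y ^ m * r → x ∣ r := by
    intro m
    induction m with
    | zero => intro r hr; simpa using hr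
    | succ m ih => intro r hr; exact ih r (hreg _ (by rwa [pow_succ', mul_assoc] at hr))
  induction k with
  | zero => intro r _; simp
  | succ k ih =>
    intro r hr
    obtain ⟨r', rfl⟩ := hpow m r ((dvd_pow_self x k.succ_ne_zero).trans hr)
    rw [pow_succ', mul_left_comm] at hr
    rw [pow_succ']
    exact mul_dvd_mul_left x (ih r' ((mul_dvd_mul_iff_left hx).mp hr))

-- The relation `1 ∈ a⁻¹ O[a⁻¹]`, multiplied by a high power of `a`, becomes a monic equation for
-- `a`.
open Polynomial in
theorem isIntegral_of_inv_mul_aeval_eq_one {O K : Type*} [CommRing O] [Field K] [Algebra O K]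
    {a : K} {h : O[X]} (hh : a⁻¹ * aeval a⁻¹ h = 1) : IsIntegral O a := by
  nontriviality O
  have ha : a ≠ 0 := by rintro rfl; simp at hh
  set d := h.natDegree
  have hdeg : (∑ i ∈ Finset.range (d + 1), C (h.coeff i) * X ^ (d - i)).degree ≤ (d : WithBot ℕ) :=
    (degree_sum_le _ _).trans <| Finset.sup_le fun i _ =>
      (degree_C_mul_X_pow_le _ _).trans <| by exact_mod_cast Nat.sub_le d i
  refine ⟨X ^ (d + 1) - ∑ i ∈ Finset.range (d + 1), C (h.coeff i) * X ^ (d - i),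
    monic_X_pow_sub (hdeg.trans_lt (by exact_mod_cast d.lt_succ_self)), ?_⟩
  have key : a = aeval a⁻¹ h := by
    calc a = a * (a⁻¹ * aeval a⁻¹ h) := by rw [hh, mul_one]
      _ = _ := by rw [← mul_assoc, mul_inv_cancel₀ ha, one_mul]
  rw [← aeval_def, map_sub, map_pow, aeval_X, sub_eq_zero, pow_succ]
  nth_rewrite 2 [key]
  rw [aeval_eq_sum_range, map_sum, Finset.mul_sum]
  refine Finset.sum_congr rfl fun i hi => ?_
  have hi' : i ≤ d := Nat.lt_succ_iff.mp (Finset.mem_range.mp hi)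
  have h1 : a ^ i * a⁻¹ ^ i = 1 := by rw [← mul_pow, mul_inv_cancel₀ ha, one_pow]
  have h2 : a ^ d = a ^ (d - i) * a ^ i := by rw [← pow_add, Nat.sub_add_cancel hi']
  simp only [map_mul, aeval_C, map_pow, aeval_X, h2, Algebra.smul_def]
  linear_combination (a ^ (d - i) * algebraMap O K (h.coeff i)) * h1

open Polynomial in
/-- Let `y` be a nonzerodivisor modulo `x`. If `a ∈ O[1/x]` and `y a` is integral over `O`, then
`a` is integral over `O`. -/
theorem isIntegral_of_regular_mul {O K : Type*} [CommRing O] [IsDomain O] [IsNoetherianRing O]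
    [Field K] [Algebra O K] (hinj : Function.Injective (algebraMap O K)) {x y : O} (hx : x ≠ 0)
    (hreg : ∀ r, x ∣ y * r → x ∣ r) {a : K} {k : ℕ} {r : O}
    (ha : algebraMap O K r = algebraMap O K x ^ k * a)
    (hy : IsIntegral O (algebraMap O K y * a)) : IsIntegral O a := by
  rcases eq_or_ne a 0 with rfl | ha0
  · exact isIntegral_zero
  have hxK : algebraMap O K x ≠ 0 := (map_ne_zero_iff _ hinj).mpr hx
  have hr0 : r ≠ 0 := by
    rintro rfl
    simp [hxK, ha0] at ha
  have hw : algebraMap O K r * a⁻¹ = algebraMap O K (x ^ k) := by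
    rw [ha, map_pow]; field_simp
  obtain ⟨N, hN⟩ := exists_pow_mul_dvd_of_aeval_eq_zero hinj hw
  set f : O[X] := C r * X - C (x ^ k) with hf
  have hf0 : f.coeff 0 = -x ^ k := by simp [hf, -map_pow]
  have hfw : aeval a⁻¹ f = 0 := by simp [hf, hw]
  -- a polynomial vanishing at `a⁻¹` whose constant term is a power of `y`
  obtain ⟨h, m, hh, hh0⟩ : ∃ (h : O[X]) (m : ℕ), aeval a⁻¹ h = 0 ∧ h.coeff 0 = y ^ m := by
    obtain ⟨p, hp, hpa⟩ := hy
    -- The reversed integral equation of `y a`: its monic leading term becomes the constant term.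
    refine ⟨∑ i ∈ Finset.range (p.natDegree + 1), C (p.coeff i * y ^ i) * X ^ (p.natDegree - i),
      p.natDegree, ?_, ?_⟩
    · rw [eval₂_eq_sum_range] at hpa
      have : a⁻¹ ^ p.natDegree * ∑ i ∈ Finset.range (p.natDegree + 1),
          algebraMap O K (p.coeff i) * (algebraMap O K y * a) ^ i = 0 := by rw [hpa, mul_zero]
      rw [← this, map_sum, Finset.mul_sum]
      refine Finset.sum_congr rfl fun i hi => ?_
      have hi' : i ≤ p.natDegree := Nat.lt_succ_iff.mp (Finset.mem_range.mp hi)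
      have : a⁻¹ ^ p.natDegree = a⁻¹ ^ (p.natDegree - i) * a⁻¹ ^ i := by
        rw [← pow_add, Nat.sub_add_cancel hi']
      simp only [map_mul, aeval_C, map_pow, aeval_X, this, mul_pow]
      have h1 : a⁻¹ ^ i * a ^ i = 1 := by rw [← mul_pow, inv_mul_cancel₀ ha0, one_pow]
      linear_combination (-(algebraMap O K (p.coeff i)) * algebraMap O K y ^ i *
        a⁻¹ ^ (p.natDegree - i)) * h1
    · rw [finsetSum_coeff, Finset.sum_range_succ, Finset.sum_eq_zero]
      · simp [hp.coeff_natDegree, -map_pow]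
      · intro i hi
        rw [coeff_C_mul, coeff_X_pow, if_neg, mul_zero]
        have := Finset.mem_range.mp hi
        omega
  -- `X` is regular modulo `f`
  have hXreg : ∀ (n : ℕ) (p : O[X]), f ∣ X ^ n * p → f ∣ p := by
    intro n
    induction n with
    | zero => intro p hp; simpa using hp
    | succ n ih =>
      intro p hp
      refine ih p ?_
      obtain ⟨q, hq⟩ := hp
      have hq0 : q.coeff 0 = 0 := by
        have := congrArg (fun p => coeff p 0) hq
        simp only [mul_coeff_zero, hf0, coeff_X_pow, pow_succ] at this
        simpa [hx] using this
      obtain ⟨q', rfl⟩ := X_dvd_iff.mpr hq0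
      exact ⟨q', mul_left_cancel₀ X_ne_zero (by rw [← mul_assoc, ← pow_succ', hq]; ring)⟩
  let M := O[X] ⧸ Ideal.span {f}
  let c : O[X] := C (r ^ N)
  -- If `c` is divisible by all powers of `X` modulo `f`, Krull's intersection theorem gives `(X q'
  -- - 1) c ∈ (f)`; evaluation at `a⁻¹` yields `a⁻¹ q'(a⁻¹) = 1`.
  by_cases hc : Ideal.Quotient.mk (Ideal.span {f}) c ∈
      (⨅ i : ℕ, (Ideal.span {(X : O[X])}) ^ i • (⊤ : Submodule O[X] M))
  · obtain ⟨⟨q, hq⟩, hqc⟩ := (Ideal.mem_iInf_smul_pow_eq_bot_iff _ _).mp hc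
    obtain ⟨q', rfl⟩ := Ideal.mem_span_singleton.mp hq
    have h1 : f ∣ X * q' * c - c := by
      rw [← Ideal.mem_span_singleton, ← Ideal.Quotient.eq]
      exact hqc
    obtain ⟨g, hg⟩ := h1
    have h2 := congrArg (aeval a⁻¹) hg
    simp only [map_sub, map_mul, aeval_X, hfw, zero_mul, c, aeval_C, map_pow] at h2
    have h3 : algebraMap O K r ^ N ≠ 0 := pow_ne_zero _ ((map_ne_zero_iff _ hinj).mpr hr0)
    refine isIntegral_of_inv_mul_aeval_eq_one (h := q') (mul_right_cancel₀ h3 ?_)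
    linear_combination h2
  · exfalso
    -- decompose `c = X ^ n * p + f * g` with `n` maximal
    have hdec : ∃ n : ℕ, ¬ ∃ p, f ∣ c - X ^ n * p := by
      by_contra! hall
      refine hc ?_
      rw [Submodule.mem_iInf]
      intro i
      obtain ⟨p, hp⟩ := hall i
      have : Ideal.Quotient.mk (Ideal.span {f}) c =
          (X ^ i : O[X]) • (Ideal.Quotient.mk (Ideal.span {f}) p) := by
        rw [← Ideal.mem_span_singleton, ← Ideal.Quotient.eq] at hp
        exact hp
      rw [this]
      exact Submodule.smul_mem_smul (Ideal.pow_mem_pow (Ideal.mem_span_singleton_self _) i) trivial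
    classical
    obtain ⟨n, hn⟩ : ∃ n, Nat.find hdec = n + 1 :=
      Nat.exists_eq_succ_of_ne_zero fun h0 => by
        have := Nat.find_spec hdec
        rw [h0] at this
        exact this ⟨c, by simp⟩
    have hmax := Nat.find_spec hdec
    rw [hn] at hmax
    obtain ⟨p, g, hp⟩ := not_not.mp (Nat.find_min hdec (m := n) (by omega))
    have hhp : f ∣ h * p := by
      refine hXreg n _ ?_
      have : X ^ n * (h * p) = c * h - f * (g * h) := by linear_combination (-h) * hp
      rw [this]
      exact dvd_sub (hN h hh) (dvd_mul_right _ _)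
    obtain ⟨q, hq⟩ := hhp
    -- Constant terms give `x ^ k ∣ y ^ m * p(0)`, hence `p(0) = x ^ k d`. Since `x ^ k ≡ r X`
    -- modulo `f`, one more factor `X` comes out of `p`, against the maximality of `n`.
    have hq0 := congrArg (fun p => coeff p 0) hq
    simp only [mul_coeff_zero, hh0, hf0] at hq0
    obtain ⟨d, hd⟩ := pow_dvd_of_pow_dvd_pow_mul hx hreg m k (p.coeff 0)
      ⟨-q.coeff 0, by rw [hq0]; ring⟩
    refine hmax ⟨p.divX + C d * C r, g - C d * X ^ n, ?_⟩
    have hpd : p = X * p.divX + C (x ^ k) * C d := by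
      conv_lhs => rw [← X_mul_divX_add p, hd, C_mul]
    rw [mul_sub, ← hp, pow_succ]
    linear_combination (X ^ n) * hpd + (C d * X ^ n) * hf

/-! ### Associated primes of a principal ideal -/

/-- The primes of the form `(x : b)`, that is, the associated primes of `O ⧸ (x)`. -/
def colonPrimes {O : Type*} [CommRing O] (x : O) : Set (Ideal O) :=
  {M | M.IsPrime ∧ ∃ b, ∀ s, s ∈ M ↔ x ∣ s * b}

theorem colonPrimes_eq_associatedPrimes {O : Type*} [CommRing O] [IsNoetherianRing O] (x : O) :
    colonPrimes x = associatedPrimes O (O ⧸ Ideal.span {x}) := by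
  have key : ∀ s b : O, s • Ideal.Quotient.mk (Ideal.span {x}) b = 0 ↔ x ∣ s * b := fun s b => by
    rw [← Ideal.mem_span_singleton, ← Ideal.Quotient.eq_zero_iff_mem]; rfl
  ext M
  rw [AssociatedPrimes.mem_iff, isAssociatedPrime_iff]
  refine and_congr_right fun _ => ⟨fun ⟨b, hb⟩ => ⟨Ideal.Quotient.mk _ b, ?_⟩, fun ⟨b, hb⟩ => ?_⟩
  · ext s
    rw [hb, Submodule.mem_colon_singleton, Submodule.mem_bot, key]
  · obtain ⟨b, rfl⟩ := Ideal.Quotient.mk_surjective b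
    exact ⟨b, fun s => by rw [hb, Submodule.mem_colon_singleton, Submodule.mem_bot, key]⟩

theorem finite_colonPrimes {O : Type*} [CommRing O] [IsNoetherianRing O] (x : O) :
    (colonPrimes x).Finite := by
  rw [colonPrimes_eq_associatedPrimes]
  exact associatedPrimes.finite O _

/-- Zero divisors modulo `x` form the union of the finitely many associated primes, so prime
avoidance applies. -/
theorem exists_le_colonPrimes {O : Type*} [CommRing O] [IsNoetherianRing O] {x : O} {I : Ideal O}
    (hI : ∀ y ∈ I, ∃ r, x ∣ y * r ∧ ¬ x ∣ r) : ∃ M ∈ colonPrimes x, I ≤ M := by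
  refine (Ideal.subset_union_prime_finite (finite_colonPrimes x) (f := id) ⊥ ⊥
    fun M hM _ _ => hM.1).mp fun y hy => ?_
  obtain ⟨r, hr, hxr⟩ := hI y hy
  have := (biUnion_associatedPrimes_eq_zero_divisors O (O ⧸ Ideal.span {x})).ge
    ⟨Ideal.Quotient.mk _ r, by rwa [Ne, Ideal.Quotient.eq_zero_iff_mem, Ideal.mem_span_singleton],
      show Ideal.Quotient.mk _ (y * r) = 0 by
        rwa [Ideal.Quotient.eq_zero_iff_mem, Ideal.mem_span_singleton]⟩
  rw [colonPrimes_eq_associatedPrimes]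
  exact this

theorem mem_colonPrimes_of_localization {R O : Type*} [CommRing R] [IsNoetherianRing R]
    [CommRing O] [Algebra R O] (P : Ideal R) [hP : P.IsPrime]
    [IsLocalization.AtPrime O P] {x : R} {M : Ideal O} (hM : M ∈ colonPrimes (algebraMap R O x))
    (hMP : M.comap (algebraMap R O) = P) : P ∈ colonPrimes x := by
  obtain ⟨_, b, hb⟩ := hM
  obtain ⟨⟨b', t⟩, hbt⟩ := IsLocalization.surj P.primeCompl b
  have hdvd : ∀ p : R, p ∈ P ↔ ∃ s ∈ P.primeCompl, x ∣ s * (p * b') := by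
    intro p
    have h0 : p ∈ P ↔ algebraMap R O p ∈ M := by rw [← hMP]; rfl
    rw [h0, hb]
    have hu := IsLocalization.map_units O t
    rw [← hu.dvd_mul_right, mul_assoc, hbt, ← map_mul]
    constructor
    · rintro ⟨c, hc⟩
      obtain ⟨⟨c', u⟩, hcu⟩ := IsLocalization.surj P.primeCompl c
      have : algebraMap R O (u * (p * b')) = algebraMap R O (x * c') := by
        rw [map_mul, hc, map_mul, ← hcu]; ring
      obtain ⟨v, hv⟩ := (IsLocalization.eq_iff_exists P.primeCompl O).mp this
      exact ⟨v * u, mul_mem v.2 u.2, v * c', by linear_combination hv⟩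
    · rintro ⟨s, hs, hx⟩
      have := map_dvd (algebraMap R O) hx
      rw [map_mul] at this
      exact (IsLocalization.map_units O (⟨s, hs⟩ : P.primeCompl)).dvd_mul_left.mp this
  obtain ⟨G, hG⟩ := (inferInstance : IsNoetherianRing R).noetherian P
  have hex : ∀ p : G, ∃ s ∈ P.primeCompl, x ∣ s * (p * b') := fun p =>
    (hdvd p).mp (hG ▸ Submodule.subset_span p.2)
  -- One denominator per generator of `P`; their product serves all of `P`.
  choose s hs hxs using hex
  refine ⟨hP, (∏ p, s p) * b', fun p => ⟨fun hp => ?_, fun hp =>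
    (hdvd p).mpr ⟨∏ p, s p, prod_mem fun p _ => hs p, by convert hp using 1; ring⟩⟩⟩
  have hle : P ≤ (Ideal.span {x}).colon {(∏ p, s p) * b'} := by
    rw [← hG, Submodule.span_le]
    intro g hg
    rw [SetLike.mem_coe, Submodule.mem_colon_singleton, smul_eq_mul, Ideal.mem_span_singleton]
    obtain ⟨c, hc⟩ := Finset.dvd_prod_of_mem s (Finset.mem_univ ⟨g, hg⟩)
    rw [hc]
    exact ((hxs ⟨g, hg⟩).mul_left c).trans (dvd_of_eq (by simp only; ring))
  have := hle hp
  rwa [Submodule.mem_colon_singleton, smul_eq_mul, Ideal.mem_span_singleton] at this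

/-! ### The integral part of the ideal transform and its Noetherianity -/

/-- The integral elements of the ideal transform of `O` with respect to `m`. -/
def integralTransform (O K : Type*) [CommRing O] [Field K] [Algebra O K] (m : Ideal O) :
    Subalgebra O K where
  carrier := {a | IsIntegral O a ∧
    ∃ k, ∀ p ∈ m ^ k, ∃ o, algebraMap O K o = algebraMap O K p * a}
  mul_mem' := by
    rintro a b ⟨ha, k, hk⟩ ⟨hb, l, hl⟩
    refine ⟨ha.mul hb, k + l, fun p hp => ?_⟩
    rw [pow_add] at hp
    refine Submodule.mul_induction_on hp (fun u hu v hv => ?_) ?_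
    · obtain ⟨o, ho⟩ := hk u hu
      obtain ⟨o', ho'⟩ := hl v hv
      exact ⟨o * o', by rw [map_mul, map_mul, ho, ho']; ring⟩
    · rintro u v ⟨o, ho⟩ ⟨o', ho'⟩
      exact ⟨o + o', by rw [map_add, map_add, ho, ho']; ring⟩
  add_mem' := by
    rintro a b ⟨ha, k, hk⟩ ⟨hb, l, hl⟩
    refine ⟨ha.add hb, k + l, fun p hp => ?_⟩
    obtain ⟨o, ho⟩ := hk p (Ideal.pow_le_pow_right (Nat.le_add_right k l) hp)
    obtain ⟨o', ho'⟩ := hl p (Ideal.pow_le_pow_right (Nat.le_add_left l k) hp)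
    exact ⟨o + o', by rw [map_add, ho, ho']; ring⟩
  algebraMap_mem' r := ⟨isIntegral_algebraMap, 0, fun p _ => ⟨p * r, map_mul _ _ _⟩⟩

/-- An integral element multiplied by `m` into the transform lies in the transform. -/
theorem mem_integralTransform_of_mul_mem {O K : Type*} [CommRing O] [IsNoetherianRing O] [Field K]
    [Algebra O K] {m : Ideal O} {a : K} (ha : IsIntegral O a)
    (hm : ∀ p ∈ m, algebraMap O K p * a ∈ integralTransform O K m) :
    a ∈ integralTransform O K m := by
  -- `L k` collects the `p` with `m ^ k p a ⊆ O`; stabilization gives one exponent for all `p ∈ m`.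
  let L : ℕ →o Ideal O :=
    { toFun := fun k =>
        { carrier := {p | ∀ q ∈ m ^ k, ∃ o, algebraMap O K o = algebraMap O K q *
            (algebraMap O K p * a)}
          zero_mem' := fun q _ => ⟨0, by simp⟩
          add_mem' := fun {p p'} hp hp' q hq => by
            obtain ⟨o, ho⟩ := hp q hq
            obtain ⟨o', ho'⟩ := hp' q hq
            exact ⟨o + o', by rw [map_add, map_add, ho, ho']; ring⟩
          smul_mem' := fun c p hp q hq => by
            obtain ⟨o, ho⟩ := hp q hq
            exact ⟨c * o, by rw [smul_eq_mul, map_mul, map_mul, ho]; ring⟩ }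
      monotone' := fun k l hkl p hp q hq => hp q (Ideal.pow_le_pow_right hkl hq) }
  obtain ⟨n, hn⟩ := monotone_stabilizes_iff_noetherian.mpr inferInstance L
  have hmL : ∀ p ∈ m, p ∈ L n := by
    intro p hp
    obtain ⟨-, k, hk⟩ := hm p hp
    rw [hn _ (le_max_right k n)]
    exact L.monotone (le_max_left k n) hk
  refine ⟨ha, n + 1, fun p hp => ?_⟩
  rw [pow_succ] at hp
  refine Submodule.mul_induction_on hp (fun u hu v hv => ?_) ?_
  · obtain ⟨o, ho⟩ := hmL v hv u hu
    exact ⟨o, by rw [ho, map_mul]; ring⟩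
  · rintro u v ⟨o, ho⟩ ⟨o', ho'⟩
    exact ⟨o + o', by rw [map_add, map_add, ho, ho']; ring⟩

theorem isArtinianRing_quotient_pow {O : Type*} [CommRing O] [IsNoetherianRing O] (m : Ideal O)
    [hm : m.IsMaximal] (k : ℕ) : IsArtinianRing (O ⧸ m ^ k) := by
  have : Ring.KrullDimLE 0 (O ⧸ m ^ k) := Ring.krullDimLE_zero_iff.mpr fun J hJ => by
    have hle : m ^ k ≤ J.comap (Ideal.Quotient.mk (m ^ k)) := by
      intro a ha
      rw [Ideal.mem_comap, Ideal.Quotient.eq_zero_iff_mem.mpr ha]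
      exact J.zero_mem
    have hJ' := hJ.comap (Ideal.Quotient.mk (m ^ k))
    have h1 : m = J.comap (Ideal.Quotient.mk (m ^ k)) :=
      hm.eq_of_le hJ'.ne_top (hJ'.le_of_pow_le hle)
    have : (J.comap (Ideal.Quotient.mk (m ^ k))).IsMaximal := h1 ▸ hm
    rw [← Ideal.map_comap_of_surjective _ Ideal.Quotient.mk_surjective J]
    exact Ideal.IsMaximal.map_of_surjective_of_ker_le Ideal.Quotient.mk_surjective (by
      rw [Ideal.mk_ker]; exact hle)
  exact IsNoetherianRing.isArtinianRing_of_krullDimLE_zero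

/-- A decreasing sequence of ideals between `m ^ k * N` and `N` becomes stationary. -/
theorem antitone_ideal_stabilizes {O : Type*} [CommRing O] [IsNoetherianRing O] (m : Ideal O)
    [m.IsMaximal] (k : ℕ) (N : Ideal O) (J : ℕ → Ideal O) (hJ : Antitone J)
    (hJN : ∀ n, J n ≤ N) (hkJ : ∀ n, m ^ k * N ≤ J n) : ∃ n, ∀ l, n ≤ l → J n = J l := by
  have := isArtinianRing_quotient_pow m k
  let Q := N ⧸ (m ^ k • (⊤ : Submodule O N))
  have hfin : Module.Finite (O ⧸ m ^ k) Q := Module.Finite.of_restrictScalars_finite O _ _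
  have hart : IsArtinian (O ⧸ m ^ k) Q := inferInstance
  have hart' : IsArtinian O Q :=
    isArtinian_of_surjective_algebraMap (Ideal.Quotient.mk_surjective (I := m ^ k))
  let q : N →ₗ[O] Q := Submodule.mkQ _
  let F : ℕ →o (Submodule O Q)ᵒᵈ :=
    { toFun := fun n => (Submodule.comap N.subtype (J n)).map q
      monotone' := fun a b hab => Submodule.map_mono (Submodule.comap_mono (hJ hab)) }
  obtain ⟨n, hn⟩ := IsArtinian.monotone_stabilizes F
  refine ⟨n, fun l hl => ?_⟩
  have hker : ∀ n, LinearMap.ker q ≤ Submodule.comap N.subtype (J n) := by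
    intro n
    rw [Submodule.ker_mkQ, ← Submodule.map_le_iff_le_comap, Submodule.map_smul'']
    simpa using hkJ n
  have h1 : Submodule.comap N.subtype (J n) = Submodule.comap N.subtype (J l) := by
    rw [← Submodule.comap_map_eq_self (hker n), ← Submodule.comap_map_eq_self (hker l)]
    exact congrArg (Submodule.comap q) (hn l hl)
  have h2 : ∀ i, J i = (Submodule.comap N.subtype (J i)).map N.subtype := fun i => by
    rw [Submodule.map_comap_subtype, inf_eq_right.mpr (hJN i)]
  rw [h2 n, h2 l, h1]

section

variable {O K : Type*} [CommRing O] [IsNoetherianRing O] [Field K] [Algebra O K]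

/-- Up to multiples of `x`, the elements of the transform have bounded denominator. -/
theorem exists_pow_mul_sub_mem (hinj : Function.Injective (algebraMap O K)) (m : Ideal O)
    [m.IsMaximal] {x : O} (hx0 : x ≠ 0) (hxm : x ∈ m) :
    ∃ n : ℕ, ∀ s ∈ integralTransform O K m, ∃ t ∈ integralTransform O K m, ∃ o : O,
      algebraMap O K o = algebraMap O K x ^ n * (s - algebraMap O K x * t) := by
  have hxK : algebraMap O K x ≠ 0 := (map_ne_zero_iff _ hinj).mpr hx0
  -- the contractions of the ideals `x ^ n W`
  let C : ℕ → Ideal O := fun n =>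
    { carrier := {o | ∃ s ∈ integralTransform O K m,
        algebraMap O K o = algebraMap O K x ^ n * s}
      zero_mem' := ⟨0, zero_mem _, by simp⟩
      add_mem' := by
        rintro a b ⟨s, hs, h⟩ ⟨s', hs', h'⟩
        exact ⟨s + s', add_mem hs hs', by rw [map_add, h, h']; ring⟩
      smul_mem' := by
        rintro c a ⟨s, hs, h⟩
        exact ⟨algebraMap O K c * s, mul_mem (algebraMap_mem _ c) hs, by
          rw [smul_eq_mul, map_mul, h]; ring⟩ }
  have hCanti : ∀ n, C (n + 1) ≤ C n := by
    rintro n o ⟨s, hs, h⟩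
    exact ⟨algebraMap O K x * s, mul_mem (algebraMap_mem _ x) hs, by rw [h]; ring⟩
  have hxC : Ideal.span {x} ≤ C 1 := by
    rw [Ideal.span_singleton_le_iff_mem]
    exact ⟨1, one_mem _, by ring⟩
  -- Each element of `C 1` is carried into `(x)` by some power of `m`; the ascending chain condition
  -- bounds the power.
  obtain ⟨k, hk⟩ : ∃ k, m ^ k * C 1 ≤ Ideal.span {x} := by
    let L : ℕ →o Ideal O :=
      { toFun := fun k => (Ideal.span {x}).colon (m ^ k : Ideal O)
        monotone' := fun k l hkl => Submodule.colon_mono le_rfl (Ideal.pow_le_pow_right hkl) }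
    obtain ⟨n, hn⟩ := monotone_stabilizes_iff_noetherian.mpr inferInstance L
    refine ⟨n, Ideal.mul_le.mpr fun p hp o ho => ?_⟩
    obtain ⟨s, ⟨hs, k, hk⟩, h⟩ := ho
    have ho : o ∈ L n := by
      rw [hn _ (le_max_right k n)]
      refine L.monotone (le_max_left k n) (Submodule.mem_colon.mpr fun p hp => ?_)
      obtain ⟨o', ho'⟩ := hk p hp
      refine Ideal.mem_span_singleton.mpr ⟨o', hinj ?_⟩
      rw [smul_eq_mul, map_mul, map_mul, h, ho']; ring
    rw [mul_comm]
    exact Submodule.mem_colon.mp ho p hp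
  obtain ⟨n, hn⟩ := antitone_ideal_stabilizes m k (C 1) (fun n => C (n + 1) ⊔ Ideal.span {x})
    (antitone_nat_of_succ_le fun n => sup_le_sup_right (hCanti _) _)
    (fun n => sup_le (antitone_nat_of_succ_le hCanti (Nat.le_add_left 1 n)) hxC)
    (fun n => hk.trans le_sup_right)
  have key : ∀ j : ℕ, ∀ s ∈ integralTransform O K m,
      (∃ o : O, algebraMap O K o = algebraMap O K x ^ (n + j) * s) →
      ∃ t ∈ integralTransform O K m, ∃ o : O,
        algebraMap O K o = algebraMap O K x ^ n * (s - algebraMap O K x * t) := by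
    intro j
    induction j with
    | zero => rintro s hs ⟨o, ho⟩; exact ⟨0, zero_mem _, o, by simpa using ho⟩
    | succ j ih =>
      rintro s hs ⟨o, ho⟩
      -- By stability `o = x ^ (n + j + 2) s' + x v`, so `v = x ^ (n + j) (s - x s')`: a multiple of
      -- `x` is subtracted from `s` and the exponent drops by one.
      have h1 : o ∈ C (n + j + 1) ⊔ Ideal.span {x} := Ideal.mem_sup_left ⟨s, hs, ho⟩
      rw [← hn (n + j) (Nat.le_add_right n j), hn (n + j + 1) (by omega)] at h1
      obtain ⟨u, ⟨s', hs', hu⟩, v, hv, huv⟩ := Submodule.mem_sup.mp h1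
      obtain ⟨v, rfl⟩ := Ideal.mem_span_singleton.mp hv
      obtain ⟨t, ht, o', ho'⟩ := ih (s - algebraMap O K x * s')
        (sub_mem hs (mul_mem (algebraMap_mem _ x) hs')) ⟨v, mul_left_cancel₀ hxK (by
          rw [← map_mul, eq_sub_of_add_eq' huv, map_sub, ho, hu]; ring)⟩
      exact ⟨s' + t, add_mem hs' ht, o', by rw [ho']; ring⟩
  refine ⟨n, fun s hs => ?_⟩
  obtain ⟨-, j, hj⟩ := id hs
  refine key j s hs ?_
  obtain ⟨o, ho⟩ := hj (x ^ j) (Ideal.pow_mem_pow hxm j)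
  exact ⟨x ^ n * o, by rw [map_mul, ho, map_pow, map_pow]; ring⟩

/-- Matijevic's theorem for the integral part of the transform at a maximal ideal. -/
theorem isNoetherianRing_integralTransform (hinj : Function.Injective (algebraMap O K))
    (m : Ideal O) [m.IsMaximal] {x : O} (hx0 : x ≠ 0) (hxm : x ∈ m) :
    IsNoetherianRing (integralTransform O K m) := by
  -- By Cohen's theorem, finite generation of nonzero primes suffices.
  refine IsNoetherianRing.of_prime_ne_bot fun Q _ hQ => ?_
  obtain ⟨q, hq, hq0⟩ := Submodule.exists_mem_ne_zero_of_ne_bot hQ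
  have hxK : algebraMap O K x ≠ 0 := (map_ne_zero_iff _ hinj).mpr hx0
  -- a nonzero element of `m` lying in `Q`
  obtain ⟨y, hy0, hym, hyQ⟩ : ∃ y : O, y ≠ 0 ∧ y ∈ m ∧
      algebraMap O (integralTransform O K m) y ∈ Q := by
    obtain ⟨-, k, hk⟩ := id q.2
    obtain ⟨o, ho⟩ := hk (x ^ k) (Ideal.pow_mem_pow hxm k)
    refine ⟨x * o, ?_, m.mul_mem_right _ hxm, ?_⟩
    · rw [← map_ne_zero_iff _ hinj, map_mul, ho, map_pow]
      exact mul_ne_zero hxK (mul_ne_zero (pow_ne_zero _ hxK) (by simpa using hq0))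
    · have : algebraMap O (integralTransform O K m) (x * o) =
          algebraMap O (integralTransform O K m) (x * x ^ k) * q := by
        apply Subtype.ext
        change algebraMap O K (x * o) = algebraMap O K (x * x ^ k) * q
        rw [map_mul, ho, map_mul, map_pow]; ring
      rw [this]
      exact Q.mul_mem_left _ hq
  have hyK : algebraMap O K y ≠ 0 := (map_ne_zero_iff _ hinj).mpr hy0
  obtain ⟨n, hn⟩ := exists_pow_mul_sub_mem (K := K) hinj m hy0 hym
  let W := integralTransform O K m
  let μ : W →ₗ[O] K := (LinearMap.mulLeft O (algebraMap O K y ^ n)).comp W.val.toLinearMap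
  -- Multiplication by `y ^ n` embeds `E` in `O`, so `E` is a Noetherian `O`-module. Every element
  -- of `W` is in `E` modulo `y W`, so `Q` is generated by `y` and `E ∩ Q`.
  let E : Submodule O W := (LinearMap.range (Algebra.linearMap O K)).comap μ
  have hE : IsNoetherian O E := by
    refine isNoetherian_of_injective
      ((μ.comp E.subtype).codRestrict (LinearMap.range (Algebra.linearMap O K)) fun e => e.2) ?_
    intro a b hab
    have : algebraMap O K y ^ n * ((a : W) : K) = algebraMap O K y ^ n * ((b : W) : K) :=
      congrArg Subtype.val hab
    exact Subtype.ext (Subtype.ext (mul_left_cancel₀ (pow_ne_zero n hyK) this))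
  have hFG : (E ⊓ Q.restrictScalars O).FG :=
    isNoetherian_submodule.mp hE _ inf_le_left
  obtain ⟨G, hG⟩ := hFG
  classical
  refine ⟨insert (algebraMap O W y) G, le_antisymm ?_ ?_⟩
  · rw [Submodule.span_le, Finset.coe_insert, Set.insert_subset_iff]
    refine ⟨hyQ, fun g hg => ?_⟩
    have : g ∈ E ⊓ Q.restrictScalars O := hG ▸ Submodule.subset_span hg
    exact this.2
  · intro s hs
    obtain ⟨t, ht, o, ho⟩ := hn s s.2
    have he : s - algebraMap O W y * ⟨t, ht⟩ ∈ E ⊓ Q.restrictScalars O :=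
      ⟨⟨o, ho⟩, Q.sub_mem hs (Q.mul_mem_right _ hyQ)⟩
    rw [← hG] at he
    have h1 : s - algebraMap O W y * ⟨t, ht⟩ ∈
        Submodule.span W ((insert (algebraMap O W y) G : Finset W) : Set W) :=
      Submodule.span_le_restrictScalars O W _
        (Submodule.span_mono (by simp) he)
    have h2 := add_mem h1 (Submodule.smul_mem (Submodule.span W
      ((insert (algebraMap O W y) G : Finset W) : Set W)) ⟨t, ht⟩
      (Submodule.subset_span (by simp : algebraMap O W y ∈ _)))
    convert h2 using 1
    rw [smul_eq_mul]; ring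

end

/-! ### Pigeonhole on divisors over a fixed maximal ideal -/

theorem Set.Infinite.exists_infinite_subset_forall {α ι : Type*} {I : Set ι} (hI : I.Finite)
    {p : ι → α → α → Prop} {D : Set α}
    (h : ∀ i ∈ I, ∀ s ⊆ D, s.Infinite → ∃ t ⊆ s, t.Infinite ∧ ∀ y ∈ t, ∀ z ∈ t, p i y z)
    {s : Set α} (hsD : s ⊆ D) (hs : s.Infinite) :
    ∃ t ⊆ s, t.Infinite ∧ ∀ i ∈ I, ∀ y ∈ t, ∀ z ∈ t, p i y z := by
  induction I, hI using Set.Finite.induction_on with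
  | empty => exact ⟨s, subset_rfl, hs, fun i hi => hi.elim⟩
  | @insert i I _ _ ih =>
    obtain ⟨t, hts, ht, hp⟩ := ih fun j hj => h j (Set.mem_insert_of_mem i hj)
    obtain ⟨t', hts', ht', hp'⟩ := h i (Set.mem_insert i I) t (hts.trans hsD) ht
    refine ⟨t', hts'.trans hts, ht', fun j hj y hy z hz => ?_⟩
    rcases hj with rfl | hj
    · exact hp' y hy z hz
    · exact hp j hj y (hts' hy) z (hts' hz)

theorem Set.Infinite.exists_infinite_subset_eq_of_finite_image {α β : Type*} {s : Set α}
    (hs : s.Infinite) {f : α → β} (hf : (f '' s).Finite) :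
    ∃ t ⊆ s, t.Infinite ∧ ∀ y ∈ t, ∀ z ∈ t, f y = f z := by
  by_contra! hcon
  refine hs ((hf.biUnion fun b _ => ?_ : (⋃ b ∈ f '' s, {a ∈ s | f a = b}).Finite).subset
    fun a ha => Set.mem_biUnion (Set.mem_image_of_mem f ha) ⟨ha, rfl⟩)
  by_contra hinf
  obtain ⟨y, hy, z, hz, hne⟩ := hcon {a ∈ s | f a = b} (fun a ha => ha.1) hinf
  exact hne (hy.2.trans hz.2.symm)

/-- The divisors of `x` in `O`, viewed in `K`. -/
def divisorsIn {O : Type*} (K : Type*) [CommRing O] [Field K] [Algebra O K] (x : O) : Set K :=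
  {y | ∃ u v : O, u * v = x ∧ algebraMap O K u = y}

section

variable {O K : Type*} [CommRing O] [Field K] [Algebra O K]

theorem isIntegral_of_isIntegral_integralTransform {m : Ideal O} {a : K}
    (h : IsIntegral (integralTransform O K m) a) : IsIntegral O a := by
  have : Algebra.IsIntegral O (integralTransform O K m) :=
    ⟨fun w => (isIntegral_algHom_iff (integralTransform O K m).val Subtype.val_injective).mp w.2.1⟩
  exact isIntegral_trans a h

variable [IsNoetherianRing O]

/-- Infinitely many divisors of `x` have a common order at an associated prime of `x` above `m`. -/
theorem exists_infinite_subset_mul_div_mem (hinj : Function.Injective (algebraMap O K))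
    (m : Ideal O) [m.IsMaximal] {x : O} (hx0 : x ≠ 0) (hxm : x ∈ m)
    {M : Ideal (integralTransform O K m)}
    (hM : M ∈ colonPrimes (algebraMap O (integralTransform O K m) x))
    (hmM : ∀ p ∈ m, algebraMap O (integralTransform O K m) p ∈ M)
    {s : Set K} (hsD : s ⊆ divisorsIn K x) (hs : s.Infinite) :
    ∃ t ⊆ s, t.Infinite ∧ ∀ y ∈ t, ∀ z ∈ t, ∃ w : integralTransform O K m,
      w ∉ M ∧ (w : K) * (y / z) ∈ integralTransform O K m := by
  have := isNoetherianRing_integralTransform (K := K) hinj m hx0 hxm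
  have hxK : algebraMap O K x ≠ 0 := (map_ne_zero_iff _ hinj).mpr hx0
  obtain ⟨hMp, b, hb⟩ := hM
  set τ : K := (b : K) / algebraMap O K x with hτ
  have hMτ : ∀ w : integralTransform O K m, w ∈ M ↔ (w : K) * τ ∈ integralTransform O K m := by
    intro w
    rw [hb]
    constructor
    · rintro ⟨c, hc⟩
      have h1 : (w : K) * b = algebraMap O K x * c := congrArg Subtype.val hc
      have : (w : K) * τ = c := by
        rw [hτ, ← mul_div_assoc, h1, mul_div_cancel_left₀ _ hxK]
      rw [this]
      exact c.2
    · intro h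
      refine ⟨⟨_, h⟩, Subtype.ext ?_⟩
      change (w : K) * b = algebraMap O K x * (w * τ)
      rw [hτ]; field_simp
  have hτW : τ ∉ integralTransform O K m := fun h =>
    hMp.ne_top ((Ideal.eq_top_iff_one M).mpr ((hMτ 1).mpr (by simpa using h)))
  -- `m τ ⊆ W`, so an integral `τ` would belong to `W`.
  have hτint : ¬ IsIntegral O τ := fun h =>
    hτW (mem_integralTransform_of_mul_mem h fun p hp => (hMτ _).mp (hmM p hp))
  -- Otherwise `τ` is almost integral over the Noetherian ring `W`, hence integral. This `N` bounds
  -- the order of every divisor of `x`.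
  obtain ⟨N, hN⟩ : ∃ N : ℕ, τ ^ N * algebraMap O K x ∉ integralTransform O K m := by
    by_contra! hall
    refine hτint (isIntegral_of_isIntegral_integralTransform (m := m) ?_)
    refine IsAlmostIntegral.isIntegral ⟨algebraMap O _ x, ?_, fun n => ⟨⟨_, hall n⟩, ?_⟩⟩
    · exact mem_nonZeroDivisors_of_ne_zero fun h => hxK (congrArg Subtype.val h)
    · change τ ^ n * algebraMap O K x = algebraMap O K x * τ ^ n
      exact mul_comm _ _
  have hbound : ∀ y ∈ divisorsIn K x, τ ^ N * y ∉ integralTransform O K m := by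
    rintro _ ⟨u, v, huv, rfl⟩ h
    refine hN ?_
    rw [← huv, map_mul, ← mul_assoc]
    exact mul_mem h (algebraMap_mem _ v)
  have hord : ∀ y ∈ divisorsIn K x, ∃ n, n < N ∧ τ ^ n * y ∈ integralTransform O K m ∧
      τ ^ (n + 1) * y ∉ integralTransform O K m := by
    intro y hy
    by_contra! hcon
    have : ∀ n ≤ N, τ ^ n * y ∈ integralTransform O K m := by
      intro n
      induction n with
      | zero =>
        intro _
        obtain ⟨u, v, huv, rfl⟩ := hy
        rw [pow_zero, one_mul]
        exact algebraMap_mem _ u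
      | succ n ih => exact fun hn => hcon n (by omega) (ih (by omega))
    exact hbound y hy (this N le_rfl)
  choose! ν hνN hν hν' using hord
  obtain ⟨t, hts, ht, htν⟩ := hs.exists_infinite_subset_eq_of_finite_image (f := ν)
    ((Set.finite_lt_nat N).subset (by rintro _ ⟨y, hy, rfl⟩; exact hνN y (hsD hy)))
  -- The witness is `w = τ ^ ν(z) z`: it avoids `M` because `τ w ∉ W`, and `w (y / z) = τ ^ ν(y) y`
  -- as the orders agree.
  refine ⟨t, hts, ht, fun y hy z hz => ⟨⟨_, hν z (hsD (hts hz))⟩, ?_, ?_⟩⟩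
  · rw [hMτ]
    have := hν' z (hsD (hts hz))
    rwa [pow_succ', mul_assoc, mul_comm] at this
  · obtain ⟨u, v, huv, hu⟩ := hsD (hts hz)
    have hz0 : z ≠ 0 := by
      rw [← hu, map_ne_zero_iff _ hinj]
      rintro rfl
      exact hx0 (by rw [← huv, zero_mul])
    have := hν y (hsD (hts hy))
    rw [htν y hy z hz] at this
    convert this using 1
    field_simp

/-- Among infinitely many divisors of `x ∈ m` there are infinitely many whose quotients are
integral as soon as some power of `m` makes them integral. -/
theorem exists_infinite_subset_isIntegral_of_pow (hinj : Function.Injective (algebraMap O K))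
    (m : Ideal O) [m.IsMaximal] {x : O} (hx0 : x ≠ 0) (hxm : x ∈ m)
    {s : Set K} (hsD : s ⊆ divisorsIn K x) (hs : s.Infinite) :
    ∃ t ⊆ s, t.Infinite ∧ ∀ y ∈ t, ∀ z ∈ t,
      (∃ k : ℕ, ∀ p ∈ m ^ k, IsIntegral O (algebraMap O K p * (y / z))) →
        IsIntegral O (y / z) := by
  have := isNoetherianRing_integralTransform (K := K) hinj m hx0 hxm
  let W := integralTransform O K m
  obtain ⟨t, hts, ht, h⟩ := Set.Infinite.exists_infinite_subset_forall
    (I := {M ∈ colonPrimes (algebraMap O W x) | ∀ p ∈ m, algebraMap O W p ∈ M})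
    (D := divisorsIn K x) ((finite_colonPrimes _).subset fun M hM => hM.1)
    (fun M hM s hsD hs => exists_infinite_subset_mul_div_mem hinj m hx0 hxm hM.1 hM.2 hsD hs)
    hsD hs
  refine ⟨t, hts, ht, fun y hy z hz ⟨k, hk⟩ => ?_⟩
  by_contra hint
  let I : Ideal W :=
    { carrier := {w | IsIntegral O ((w : K) * (y / z))}
      zero_mem' := by simpa using isIntegral_zero
      add_mem' := fun {a b} ha hb => by simpa [add_mul] using IsIntegral.add ha hb
      smul_mem' := fun c a ha => by simpa [mul_assoc] using IsIntegral.mul c.2.1 ha }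
  have hxW : algebraMap O W x ≠ 0 := fun h =>
    (map_ne_zero_iff _ hinj).mpr hx0 (congrArg Subtype.val h)
  obtain ⟨r, hr⟩ : ∃ r : W, algebraMap W K r = algebraMap W K (algebraMap O W x) ^ 1 * (y / z) := by
    obtain ⟨u, v, huv, rfl⟩ := hsD (hts hy)
    obtain ⟨u', v', huv', rfl⟩ := hsD (hts hz)
    have hu0 : algebraMap O K u' ≠ 0 := by
      rw [map_ne_zero_iff _ hinj]
      rintro rfl
      exact hx0 (by rw [← huv', zero_mul])
    refine ⟨algebraMap O W (u * v'), ?_⟩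
    change algebraMap O K (u * v') = algebraMap O K x ^ 1 * _
    rw [← huv', pow_one, map_mul, map_mul]
    field_simp
  -- An element of `I` regular modulo `x` would make `y / z` integral, so `I` consists of zero
  -- divisors modulo `x`. As `m ^ k ⊆ I`, the prime `M` lies above `m`, yet `I` contains an element
  -- outside `M`.
  obtain ⟨M, hM, hIM⟩ : ∃ M ∈ colonPrimes (algebraMap O W x), I ≤ M := by
    refine exists_le_colonPrimes fun w hw => ?_
    by_contra! hreg
    refine hint (isIntegral_of_isIntegral_integralTransform (m := m) ?_)
    exact isIntegral_of_regular_mul (O := W) Subtype.val_injective hxW hreg hr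
      (IsIntegral.tower_top (R := O) hw)
  have hmM : ∀ p ∈ m, algebraMap O W p ∈ M := by
    intro p hp
    refine hM.1.mem_of_pow_mem k (hIM ?_)
    change IsIntegral O (((algebraMap O W p ^ k : W) : K) * (y / z))
    have := hk (p ^ k) (Ideal.pow_mem_pow hp k)
    rwa [map_pow] at this
  obtain ⟨w, hwM, hw⟩ := h M ⟨hM, hmM⟩ y hy z hz
  exact hwM (hIM (show w ∈ I from hw.1))

end

/-! ### From localizations to the integral closure of `R` -/

section

variable {R K : Type*} [CommRing R] [Field K] [Algebra R K]

theorem isIntegral_localization_iff {O : Type*} [CommRing O] [Algebra R O] [Algebra O K]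
    [IsScalarTower R O K] (P : Ideal R) [P.IsPrime] [IsLocalization.AtPrime O P] {a : K} :
    IsIntegral O a ↔ ∃ s ∉ P, IsIntegral R (algebraMap R K s * a) := by
  constructor
  · intro h
    obtain ⟨s, hs⟩ := h.exists_multiple_integral_of_isLocalization P.primeCompl a
    exact ⟨s, s.2, by rwa [← Algebra.smul_def]⟩
  · rintro ⟨s, hs, h⟩
    obtain ⟨c, hc⟩ := (IsLocalization.map_units O (⟨s, hs⟩ : P.primeCompl)).exists_left_inv
    have h1 : IsIntegral O (algebraMap O K c * (algebraMap R K s * a)) :=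
      isIntegral_algebraMap.mul (h.tower_top)
    rwa [← mul_assoc, IsScalarTower.algebraMap_apply R O K, ← map_mul, hc, map_one, one_mul] at h1

theorem divisorsIn_subset_divisorsIn_algebraMap {O : Type*} [CommRing O] [Algebra R O]
    [Algebra O K] [IsScalarTower R O K] (x : R) :
    divisorsIn K x ⊆ divisorsIn K (algebraMap R O x) := by
  rintro _ ⟨u, v, rfl, rfl⟩
  exact ⟨algebraMap R O u, algebraMap R O v, (map_mul _ _ _).symm,
    (IsScalarTower.algebraMap_apply R O K u).symm⟩

/-- The ideal of multipliers making `a` integral. -/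
def integralMultipliers (R : Type*) {K : Type*} [CommRing R] [Field K] [Algebra R K] (a : K) :
    Ideal R where
  carrier := {s | IsIntegral R (algebraMap R K s * a)}
  zero_mem' := by simpa using isIntegral_zero
  add_mem' ha hb := by simpa [add_mul] using IsIntegral.add ha hb
  smul_mem' c s hs := by
    simpa [mul_assoc] using IsIntegral.mul (isIntegral_algebraMap (x := c)) hs

theorem mem_integralMultipliers {a : K} {s : R} :
    s ∈ integralMultipliers R a ↔ IsIntegral R (algebraMap R K s * a) := Iff.rfl

/-- After localization at `P` the radical of `I` is the maximal ideal; `P` being finitely generated,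
one power of it lies in the contraction of `I R_P`. -/
theorem exists_pow_of_mem_minimalPrimes [IsNoetherianRing R] {I P : Ideal R}
    (hP : P ∈ I.minimalPrimes) : ∃ k : ℕ, ∀ q ∈ P ^ k, ∃ s ∉ P, s * q ∈ I := by
  have hPp : P.IsPrime := hP.1.1
  let J : Ideal R :=
    { carrier := {q | ∃ s ∉ P, s * q ∈ I}
      zero_mem' := ⟨1, fun h => hPp.ne_top ((Ideal.eq_top_iff_one P).mpr h), by simp⟩
      add_mem' := by
        rintro a b ⟨s, hs, ha⟩ ⟨t, ht, hb⟩
        refine ⟨s * t, fun h => (hPp.mem_or_mem h).elim hs ht, ?_⟩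
        have : s * t * (a + b) = t * (s * a) + s * (t * b) := by ring
        rw [this]
        exact I.add_mem (I.mul_mem_left _ ha) (I.mul_mem_left _ hb)
      smul_mem' := by
        rintro c a ⟨s, hs, ha⟩
        refine ⟨s, hs, ?_⟩
        rw [smul_eq_mul, mul_left_comm]
        exact I.mul_mem_left _ ha }
  have hle : P ≤ J.radical := by
    intro q hq
    have h1 : algebraMap R (Localization.AtPrime P) q ∈
        (I.map (algebraMap R (Localization.AtPrime P))).radical := by
      rw [IsLocalization.AtPrime.radical_map_of_mem_minimalPrimes _ P I hP,
        IsLocalization.AtPrime.map_eq_maximalIdeal P (Localization.AtPrime P)]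
      exact (IsLocalization.AtPrime.to_map_mem_maximal_iff _ P q).mpr hq
    obtain ⟨n, hn⟩ := h1
    rw [← map_pow, IsLocalization.mem_map_algebraMap_iff P.primeCompl] at hn
    obtain ⟨⟨i, s⟩, his⟩ := hn
    rw [← map_mul, IsLocalization.eq_iff_exists P.primeCompl] at his
    obtain ⟨t, ht⟩ := his
    refine ⟨n, t * s, P.primeCompl.mul_mem t.2 s.2, ?_⟩
    have : (t : R) * s * q ^ n = t * i := by rw [← ht]; ring
    rw [this]
    exact I.mul_mem_left _ i.2
  obtain ⟨k, hk⟩ := Ideal.exists_pow_le_of_le_radical_of_fg hle (IsNoetherian.noetherian P)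
  exact ⟨k, fun q hq => hk hq⟩

variable [IsDomain R] [IsNoetherianRing R] [IsFractionRing R K]

/-- Minimal primes over the multiplier ideal of `a ∈ R[1/x]` are associated primes of `x`. -/
theorem mem_colonPrimes_of_mem_minimalPrimes {x : R} (hx0 : x ≠ 0) {a : K} {r : R}
    (hr : algebraMap R K r = algebraMap R K x * a) {P : Ideal R}
    (hP : P ∈ (integralMultipliers R a).minimalPrimes) : P ∈ colonPrimes x := by
  have hPp : P.IsPrime := hP.1.1
  -- The localization is taken inside `K`, so that `a` needs no transport.
  let O := Localization.subalgebra.ofField K P.primeCompl P.primeCompl_le_nonZeroDivisors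
  have : IsLocalization.AtPrime O P := Localization.subalgebra.isLocalization_ofField K _ _
  have : IsNoetherianRing O := IsLocalization.isNoetherianRing P.primeCompl O inferInstance
  have : IsLocalRing O := IsLocalization.AtPrime.isLocalRing O P
  have hinjO : Function.Injective (algebraMap O K) := Subtype.val_injective
  obtain ⟨k, hk⟩ := exists_pow_of_mem_minimalPrimes hP
  have haO : ¬ IsIntegral O a := by
    rw [isIntegral_localization_iff P]
    rintro ⟨s, hs, h⟩
    exact hs (hP.1.2 h)
  have hxO : algebraMap R O x ≠ 0 := fun h => hx0 <| by
    have : algebraMap R K x = 0 := by rw [IsScalarTower.algebraMap_apply R O K, h, map_zero]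
    simpa using this
  -- If some element of the maximal ideal were regular modulo `x`, so would be its numerator `p ∈ P`
  -- and `p ^ k`; but `p ^ k a` is integral over `O` and `a` is not.
  obtain ⟨M, hM, hmM⟩ : ∃ M ∈ colonPrimes (algebraMap R O x), IsLocalRing.maximalIdeal O ≤ M := by
    refine exists_le_colonPrimes fun y hy => ?_
    by_contra! hreg
    obtain ⟨⟨p, s⟩, hps⟩ := IsLocalization.surj P.primeCompl y
    have hp : p ∈ P := by
      rw [← IsLocalization.AtPrime.to_map_mem_maximal_iff O P p inferInstance, ← hps]
      exact Ideal.mul_mem_right _ _ hy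
    have hreg' : ∀ r, algebraMap R O x ∣ algebraMap R O (p ^ k) * r → algebraMap R O x ∣ r := by
      intro r hr
      have h1 := pow_dvd_of_pow_dvd_pow_mul hxO hreg k 1 (algebraMap R O s ^ k * r)
      rw [pow_one, ← mul_assoc, ← mul_pow, hps, ← map_pow] at h1
      exact ((IsLocalization.map_units O s).pow k).dvd_mul_left.mp (h1 hr)
    refine haO (isIntegral_of_regular_mul (k := 1) (r := algebraMap R O r) hinjO hxO hreg' ?_ ?_)
    · rw [pow_one, ← IsScalarTower.algebraMap_apply, ← IsScalarTower.algebraMap_apply, hr]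
    · rw [isIntegral_localization_iff P, ← IsScalarTower.algebraMap_apply]
      obtain ⟨s, hs, h⟩ := hk _ (Ideal.pow_mem_pow hp k)
      refine ⟨s, hs, ?_⟩
      rw [← mul_assoc, ← map_mul]
      exact h
  have hMeq : M = IsLocalRing.maximalIdeal O :=
    le_antisymm (IsLocalRing.le_maximalIdeal hM.1.ne_top) hmM
  exact mem_colonPrimes_of_localization P hM (by
    rw [hMeq]; exact IsLocalization.AtPrime.under_maximalIdeal O P inferInstance)

theorem exists_infinite_subset_isIntegral_at_prime {x : R} (hx0 : x ≠ 0) {P : Ideal R}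
    (hPp : P.IsPrime) (hxP : x ∈ P) {s : Set K} (hsD : s ⊆ divisorsIn K x) (hs : s.Infinite) :
    ∃ t ⊆ s, t.Infinite ∧ ∀ y ∈ t, ∀ z ∈ t,
      (∃ k : ℕ, ∀ q ∈ P ^ k, ∃ s ∉ P, s * q ∈ integralMultipliers R (y / z)) →
        ∃ s ∉ P, s ∈ integralMultipliers R (y / z) := by
  let O := Localization.subalgebra.ofField K P.primeCompl P.primeCompl_le_nonZeroDivisors
  have : IsLocalization.AtPrime O P := Localization.subalgebra.isLocalization_ofField K _ _
  have : IsNoetherianRing O := IsLocalization.isNoetherianRing P.primeCompl O inferInstance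
  have : IsLocalRing O := IsLocalization.AtPrime.isLocalRing O P
  have hinjO : Function.Injective (algebraMap O K) := Subtype.val_injective
  have hxO : algebraMap R O x ≠ 0 := fun h => hx0 <| by
    have : algebraMap R K x = 0 := by rw [IsScalarTower.algebraMap_apply R O K, h, map_zero]
    simpa using this
  obtain ⟨t, hts, ht, h⟩ := exists_infinite_subset_isIntegral_of_pow hinjO
    (IsLocalRing.maximalIdeal O) hxO
    ((IsLocalization.AtPrime.to_map_mem_maximal_iff O P x inferInstance).mpr hxP)
    (hsD.trans (divisorsIn_subset_divisorsIn_algebraMap x)) hs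
  refine ⟨t, hts, ht, fun y hy z hz ⟨k, hk⟩ => ?_⟩
  refine (isIntegral_localization_iff (O := O) P).mp (h y hy z hz ⟨k, fun p hp => ?_⟩)
  rw [← IsLocalization.AtPrime.map_eq_maximalIdeal P O, ← Ideal.map_pow,
    IsLocalization.mem_map_algebraMap_iff P.primeCompl] at hp
  obtain ⟨⟨q, u⟩, hqu⟩ := hp
  obtain ⟨v, hv, hvq⟩ := hk q q.2
  rw [isIntegral_localization_iff P]
  refine ⟨v * u, P.primeCompl.mul_mem hv u.2, ?_⟩
  rw [mem_integralMultipliers] at hvq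
  convert hvq using 1
  have h1 : algebraMap O K p * algebraMap R K u = algebraMap R K q := by
    rw [IsScalarTower.algebraMap_apply R O K, ← map_mul, hqu, ← IsScalarTower.algebraMap_apply]
  rw [map_mul, map_mul, ← h1]; ring

/-- Any infinite set of divisors of `x ≠ 0` in a Noetherian domain has an infinite subset whose
elements are pairwise associated in the integral closure. -/
theorem exists_infinite_subset_isIntegral_div {x : R} (hx0 : x ≠ 0) {s : Set K}
    (hsD : s ⊆ divisorsIn K x) (hs : s.Infinite) :
    ∃ t ⊆ s, t.Infinite ∧ ∀ y ∈ t, ∀ z ∈ t, IsIntegral R (y / z) := by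
  obtain ⟨t, hts, ht, h⟩ := Set.Infinite.exists_infinite_subset_forall (finite_colonPrimes x)
    (D := divisorsIn K x) (fun P hP s hsD hs => exists_infinite_subset_isIntegral_at_prime hx0 hP.1
      (by obtain ⟨-, b, hb⟩ := hP; exact (hb x).mpr (dvd_mul_right x b)) hsD hs) hsD hs
  refine ⟨t, hts, ht, fun y hy z hz => ?_⟩
  by_contra hint
  have hI : integralMultipliers R (y / z) ≠ ⊤ := fun htop => hint <| by
    have := (Ideal.eq_top_iff_one _).mp htop
    rwa [mem_integralMultipliers, map_one, one_mul] at this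
  obtain ⟨P, hP⟩ := Ideal.nonempty_minimalPrimes hI
  have hPx : P ∈ colonPrimes x := by
    obtain ⟨u, v, -, rfl⟩ := hsD (hts hy)
    obtain ⟨u', v', huv', rfl⟩ := hsD (hts hz)
    refine mem_colonPrimes_of_mem_minimalPrimes hx0 (r := u * v') ?_ hP
    have hu0 : algebraMap R K u' ≠ 0 := by
      simp only [ne_eq, FaithfulSMul.algebraMap_eq_zero_iff]
      rintro rfl
      exact hx0 (by rw [← huv', zero_mul])
    rw [← huv', map_mul, map_mul]
    field_simp
  obtain ⟨s, hs, hsI⟩ := h P hPx y hy z hz (exists_pow_of_mem_minimalPrimes hP)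
  exact hs (hP.1.2 hsI)

end

/-! ### Factorizations and divisors -/

section

variable {R : Type*} [CommRing R] [IsDomain R]

theorem IsAtomicDomain.exists_factorization (h : IsAtomicDomain R) {x : R} (hx : x ≠ 0) :
    (factorizationClasses R x).Nonempty := by
  by_cases hu : IsUnit x
  · exact ⟨0, by simp, by rw [Multiset.prod_zero, eq_comm, Associates.mk_eq_one]; exact hu⟩
  · obtain ⟨s, hs, rfl⟩ := h x hx hu
    refine ⟨s.map Associates.mk, fun a ha => ?_, Associates.prod_mk⟩
    obtain ⟨b, hb, rfl⟩ := Multiset.mem_map.mp ha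
    exact Associates.irreducible_mk.mpr (hs b hb)

theorem IsFFD.finite_factorizationClasses (h : IsFFD R) {x : R} (hx : x ≠ 0) :
    (factorizationClasses R x).Finite := by
  by_cases hu : IsUnit x
  · refine (Set.finite_singleton 0).subset fun z hz => ?_
    rw [Set.mem_singleton_iff]
    refine Multiset.eq_zero_of_forall_notMem fun a ha => (hz.1 a ha).not_isUnit ?_
    refine isUnit_of_dvd_unit (Multiset.dvd_prod ha) ?_
    rw [hz.2]
    exact Associates.isUnit_mk.mpr hu
  · exact h.finite_factorizations x hx hu

/-- In a finite factorization domain a nonzero element has finitely many divisors, up to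
associates. -/
theorem IsFFD.finite_divisors (h : IsFFD R) {x : R} (hx : x ≠ 0) :
    {d : Associates R | d ∣ Associates.mk x}.Finite := by
  refine ((h.finite_factorizationClasses hx).biUnion fun z _ =>
    ((Multiset.finite_toSet z.powerset).image Multiset.prod)).subset fun d hd => ?_
  obtain ⟨u, rfl⟩ := Associates.mk_surjective d
  obtain ⟨v, rfl⟩ := Associates.mk_dvd_mk.mp hd
  obtain ⟨z, hz, hzu⟩ := h.atomic.exists_factorization (left_ne_zero_of_mul hx)
  obtain ⟨w, hw, hwv⟩ := h.atomic.exists_factorization (right_ne_zero_of_mul hx)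
  refine Set.mem_biUnion (x := z + w) ⟨fun a ha => ?_, ?_⟩
    ⟨z, Multiset.mem_powerset.mpr (Multiset.le_add_right z w), hzu⟩
  · exact (Multiset.mem_add.mp ha).elim (hz a) (hw a)
  · rw [Multiset.prod_add, hzu, hwv, Associates.mk_mul_mk]

/-- Well-founded induction on proper divisibility: a nonempty factorization of `q` is an irreducible
divisor of `q` followed by a factorization of the cofactor. -/
theorem isFFD_of_finite_divisors [IsNoetherianRing R]
    (h : ∀ x : R, x ≠ 0 → {d : Associates R | d ∣ Associates.mk x}.Finite) : IsFFD R where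
  atomic x hx hu := by
    obtain ⟨f, hf, hfx, -⟩ := (WfDvdMonoid.not_isUnit_iff_exists_factors_eq x hx).mp hu
    exact ⟨f, hf, hfx⟩
  finite_factorizations := by
    have key : ∀ q : Associates R, q ≠ 0 →
        {z : Multiset (Associates R) | (∀ a ∈ z, Irreducible a) ∧ z.prod = q}.Finite := by
      intro q
      induction q using (IsWellFounded.wf (r := DvdNotUnit (α := Associates R))).induction with
      | _ q ih =>
      intro hq
      have hD : {d : Associates R | d ∣ q}.Finite := by
        obtain ⟨x, rfl⟩ := Associates.mk_surjective q
        exact h x (Associates.mk_ne_zero.mp hq)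
      have hpairs : {p : Associates R × Associates R | Irreducible p.1 ∧ p.1 * p.2 = q}.Finite :=
        (hD.prod hD).subset fun p hp => ⟨⟨p.2, hp.2.symm⟩, ⟨p.1, by rw [mul_comm]; exact hp.2.symm⟩⟩
      refine ((Set.finite_singleton 0).union (hpairs.biUnion' fun p hp =>
        (ih p.2 ⟨?_, p.1, hp.1.not_isUnit, ?_⟩ ?_).image (Multiset.cons p.1))).subset fun z hz => ?_
      · exact right_ne_zero_of_mul (hp.2 ▸ hq)
      · rw [mul_comm]; exact hp.2.symm
      · exact right_ne_zero_of_mul (hp.2 ▸ hq)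
      · induction z using Multiset.induction_on with
        | empty => exact Or.inl rfl
        | cons a z _ =>
          have hp : Irreducible a ∧ a * z.prod = q :=
            ⟨hz.1 a (Multiset.mem_cons_self a z), by rw [← Multiset.prod_cons]; exact hz.2⟩
          exact Or.inr (Set.mem_iUnion₂.mpr ⟨(a, z.prod), hp, z,
            ⟨fun b hb => hz.1 b (Multiset.mem_cons_of_mem hb), rfl⟩, rfl⟩)
    exact fun x hx _ => key _ (Associates.mk_ne_zero.mpr hx)

theorem IsFFD.of_ringEquiv [IsNoetherianRing R] {T : Type*} [CommRing T] [IsDomain T]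
    (e : R ≃+* T) (h : IsFFD R) : IsFFD T := by
  have : IsNoetherianRing T := isNoetherianRing_of_ringEquiv R e
  refine isFFD_of_finite_divisors fun x hx => ?_
  have hx' : e.symm x ≠ 0 := by simpa using hx
  refine ((h.finite_divisors hx').image fun d => Associates.mk (e (Quot.out d))).subset
    fun d hd => ?_
  obtain ⟨u, rfl⟩ := Associates.mk_surjective d
  refine ⟨Associates.mk (e.symm u),
    Associates.mk_dvd_mk.mpr (map_dvd e.symm (Associates.mk_dvd_mk.mp hd)), ?_⟩
  have hass : Associated (Quot.out (Associates.mk (e.symm u))) (e.symm u) := by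
    rw [← Associates.mk_eq_mk_iff_associated, Associates.quot_out]
  have := hass.map (e : R →* T)
  rw [Associates.mk_eq_mk_iff_associated]
  simpa using this

end

/-! ### Unit quotients of module-finite overrings -/

section

variable {R K : Type*} [CommRing R] [IsDomain R] [Field K] [Algebra R K] [IsFractionRing R K]

theorem exists_mul_mem_range_of_finite (S : Subalgebra R K) [Module.Finite R S] :
    ∃ c : R, c ≠ 0 ∧ ∀ s ∈ S, ∃ r : R, algebraMap R K r = algebraMap R K c * s := by
  have hfg : (Subalgebra.toSubmodule S).FG := Module.Finite.iff_fg.mp ‹_›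
  obtain ⟨G, hG⟩ := hfg
  obtain ⟨c, hc⟩ := IsLocalization.exist_integer_multiples_of_finset (nonZeroDivisors R) G
  refine ⟨c, nonZeroDivisors.ne_zero c.2, fun s hs => ?_⟩
  have hs' : s ∈ Submodule.span R (G : Set K) := by rw [hG]; exact hs
  induction hs' using Submodule.span_induction with
  | mem g hg =>
    obtain ⟨r, hr⟩ := hc g hg
    exact ⟨r, by rw [hr, Algebra.smul_def]⟩
  | zero => exact ⟨0, by simp⟩
  | add a b ha hb iha ihb =>
    obtain ⟨r, hr⟩ := iha (by rw [hG] at ha; exact ha)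
    obtain ⟨r', hr'⟩ := ihb (by rw [hG] at hb; exact hb)
    exact ⟨r + r', by rw [map_add, hr, hr']; ring⟩
  | smul d a ha iha =>
    obtain ⟨r, hr⟩ := iha (by rw [hG] at ha; exact ha)
    exact ⟨d * r, by rw [map_mul, hr, Algebra.smul_def]; ring⟩

/-- If `R` is a finite factorization domain, then `U(S) / U(R)` is finite for finite overrings `S`. -/
theorem IsFFD.finite_unitsQuotient (h : IsFFD R) (S : Subalgebra R K) [Module.Finite R S] :
    Finite (UnitsQuotient R S) := by
  obtain ⟨c, hc0, hc⟩ := exists_mul_mem_range_of_finite S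
  have hcK : algebraMap R K c ≠ 0 := by simpa using hc0
  choose! f hf using hc
  -- `f u` is `c u`, and `(c u) (c u⁻¹) = c ^ 2`.
  have hdvd : ∀ u : Sˣ, f (u : S) ∣ c * c := by
    intro u
    refine ⟨f ((u⁻¹ : Sˣ) : S), IsFractionRing.injective R K ?_⟩
    have h1 : ((u : S) : K) * ((u⁻¹ : Sˣ) : S) = 1 := congrArg Subtype.val u.mul_inv
    rw [map_mul, map_mul, hf _ (u : S).2, hf _ ((u⁻¹ : Sˣ) : S).2]
    linear_combination (-(algebraMap R K c) ^ 2) * h1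
  have := (h.finite_divisors (mul_ne_zero hc0 hc0)).to_subtype
  let g : UnitsQuotient R S → {d : Associates R | d ∣ Associates.mk (c * c)} := fun q =>
    ⟨Associates.mk (f (q.out : S)), Associates.mk_dvd_mk.mpr (hdvd q.out)⟩
  refine Finite.of_injective g fun q q' hq => ?_
  have hassoc : Associated (f (q.out : S)) (f (q'.out : S)) :=
    Associates.mk_eq_mk_iff_associated.mp (congrArg Subtype.val hq)
  obtain ⟨v, hv⟩ := hassoc
  rw [← q.out_eq', ← q'.out_eq']
  refine QuotientGroup.eq.mpr ⟨v, ?_⟩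
  rw [eq_inv_mul_iff_mul_eq]
  refine Units.ext (Subtype.ext ?_)
  have h1 := congrArg (algebraMap R K) hv
  rw [map_mul, hf _ (q.out : S).2, hf _ (q'.out : S).2, mul_assoc] at h1
  exact mul_left_cancel₀ hcK h1

variable [IsNoetherianRing R]

/-- If divisors of nonzero elements fall into finitely many classes modulo the units of an integral
overring `T`, and finite extensions inside `T` have finite unit quotients, then `R` is an FFD. -/
theorem isFFD_of_exists_infinite_subset_div_mem (T : Subalgebra R K)
    (hT : ∀ a ∈ T, IsIntegral R a)
    (hdiv : ∀ x : R, x ≠ 0 → ∀ s ⊆ divisorsIn K x, s.Infinite →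
      ∃ t ⊆ s, t.Infinite ∧ ∀ y ∈ t, ∀ z ∈ t, y / z ∈ T)
    (hfin : ∀ S : Subalgebra R K, S ≤ T → Module.Finite R S → Finite (UnitsQuotient R S)) :
    IsFFD R := by
  refine isFFD_of_finite_divisors fun x hx => ?_
  by_contra hinf
  let ρ : Associates R → K := fun d => algebraMap R K (Quot.out d)
  have hρ : Function.Injective ρ := fun d d' hd => by
    rw [← Associates.quot_out d, ← Associates.quot_out d', IsFractionRing.injective R K hd]
  obtain ⟨t, hts, ht, hT'⟩ := hdiv x hx (ρ '' {d | d ∣ Associates.mk x})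
    (by
      rintro _ ⟨d, hd, rfl⟩
      obtain ⟨v, hv⟩ : Quot.out d ∣ x := by
        rw [← Associates.mk_dvd_mk, Associates.quot_out]; exact hd
      exact ⟨_, v, hv.symm, rfl⟩)
    (Set.Infinite.image hρ.injOn hinf)
  have hassoc : ∀ y ∈ t, ∀ z ∈ t, ∀ u : Rˣ, z = y * algebraMap R K u → y = z := by
    intro y hy z hz u hu
    obtain ⟨d, -, rfl⟩ := hts hy
    obtain ⟨d', -, rfl⟩ := hts hz
    refine congrArg ρ ?_
    rw [← Associates.quot_out d, ← Associates.quot_out d', Associates.mk_eq_mk_iff_associated]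
    exact ⟨u, IsFractionRing.injective R K (by rw [map_mul]; exact hu.symm)⟩
  have ht0 : ∀ y ∈ t, y ≠ 0 := by
    intro y hy h0
    obtain ⟨d, hd, rfl⟩ := hts hy
    have : Quot.out d = 0 := by simpa [ρ] using h0
    rw [← Associates.quot_out d, this] at hd
    exact hx (zero_dvd_iff.mp (Associates.mk_dvd_mk.mp hd))
  obtain ⟨y₀, hy₀⟩ := ht.nonempty
  -- the quotients `y / y₀` lie in a finite extension of `R` inside `T`
  let U : Set K := (fun y => y / y₀) '' t
  have hUfg : (Submodule.span R U).FG := by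
    have hle : Submodule.span R U ≤ Submodule.span R {y₀⁻¹} := by
      rw [Submodule.span_le]
      rintro _ ⟨y, hy, rfl⟩
      obtain ⟨d, -, rfl⟩ := hts hy
      refine Submodule.mem_span_singleton.mpr ⟨Quot.out d, ?_⟩
      rw [Algebra.smul_def, ← div_eq_mul_inv]
    have : IsNoetherian R (Submodule.span R {y₀⁻¹}) :=
      isNoetherian_span_of_finite R (Set.finite_singleton _)
    exact isNoetherian_submodule.mp this _ hle
  -- Generators are chosen among the quotients themselves, so that they lie in `T` and are integral.
  obtain ⟨G, hGU, hG⟩ := (Submodule.fg_span_iff_fg_span_finset_subset U).mp hUfg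
  have hUT : U ⊆ T := by
    rintro _ ⟨y, hy, rfl⟩
    exact hT' y hy y₀ hy₀
  let S : Subalgebra R K := Algebra.adjoin R (G : Set K)
  have hST : S ≤ T := Algebra.adjoin_le (hGU.trans hUT)
  have hSfin : Module.Finite R S := Module.Finite.iff_fg.mpr
    (fg_adjoin_of_finite G.finite_toSet fun g hg => hT g (hUT (hGU hg)))
  have hSint : Algebra.IsIntegral R S := inferInstance
  have hUS : ∀ y ∈ t, y / y₀ ∈ S := by
    intro y hy
    have : y / y₀ ∈ Submodule.span R (G : Set K) := hG ▸ Submodule.subset_span ⟨y, hy, rfl⟩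
    exact Algebra.span_le_adjoin R _ this
  have hunit : ∀ y ∈ t, ∃ u : Sˣ, ((u : S) : K) = y / y₀ := by
    intro y hy
    have hint : IsIntegral S (y / y₀)⁻¹ := by
      rw [inv_div]
      exact (hT _ (hT' y₀ hy₀ y hy)).tower_top
    let v : integralClosure S K := ⟨_, hint⟩
    -- The inverse `y₀ / y` is only known to be integral over `S`; integral extensions reflect
    -- units, which puts it in `S`.
    have hv : IsUnit (algebraMap S (integralClosure S K) ⟨_, hUS y hy⟩) :=
      .of_mul_eq_one v (Subtype.ext
        (mul_inv_cancel₀ (div_ne_zero (ht0 y hy) (ht0 y₀ hy₀))))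
    have hC : Algebra.IsIntegral S (integralClosure S K) := inferInstance
    have hloc := (algebraMap_isIntegral_iff.mpr hC).isLocalHom
      fun a b hab => Subtype.ext (congrArg (fun c : integralClosure S K => (c : K)) hab)
    obtain ⟨u, hu⟩ := hloc.map_nonunit _ hv
    exact ⟨u, congrArg Subtype.val hu⟩
  have hQ := hfin S hST hSfin
  choose! υ hυ using hunit
  obtain ⟨t', ht't, ht', hc⟩ := ht.exists_infinite_subset_eq_of_finite_image
    (f := fun y => (QuotientGroup.mk (υ y) : UnitsQuotient R S)) (Set.toFinite _)
  refine ht' (Set.Subsingleton.finite fun y hy z hz => ?_)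
  obtain ⟨v, hv⟩ := QuotientGroup.eq.mp (hc y hy z hz)
  rw [eq_inv_mul_iff_mul_eq] at hv
  refine hassoc y (ht't hy) z (ht't hz) v ?_
  have h1 : ((υ y : S) : K) * algebraMap R K v = (υ z : S) :=
    congrArg (fun u : Sˣ => ((u : S) : K)) hv
  rw [hυ y (ht't hy), hυ z (ht't hz), div_mul_eq_mul_div,
    div_left_inj' (ht0 y₀ hy₀)] at h1
  exact h1.symm

end

theorem mainTheorem10 (R : Type*) [CommRing R] [IsDomain R] [IsNoetherianRing R]
    (K : Type*) [Field K] [Algebra R K] [IsFractionRing R K] :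
    List.TFAE [
      IsFFD R,
      ∀ S : Subalgebra R K, Module.Finite R S → Finite (UnitsQuotient R S),
      ∃ T : Subalgebra R K, IsFFD T ∧ Algebra.IsIntegral R T ∧
        ∀ S : Subalgebra R K, S ≤ T → Module.Finite R S → Finite (UnitsQuotient R S)] := by
  tfae_have 1 → 2 := fun h S _ => h.finite_unitsQuotient S
  tfae_have 1 → 3 := fun h => by
    have e := (Algebra.botEquivOfInjective (IsFractionRing.injective R K)).symm
    refine ⟨⊥, h.of_ringEquiv e.toRingEquiv, ⟨fun a => ?_⟩, fun S _ _ => h.finite_unitsQuotient S⟩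
    obtain ⟨r, rfl⟩ := e.surjective a
    have : e r = algebraMap R _ r := e.commutes r
    rw [this]
    exact isIntegral_algebraMap
  tfae_have 2 → 1 := fun h =>
    isFFD_of_exists_infinite_subset_div_mem (integralClosure R K) (fun a ha => ha)
      (fun x hx s hsD hs => exists_infinite_subset_isIntegral_div hx hsD hs) fun S _ => h S
  tfae_have 3 → 1 := by
    rintro ⟨T, hTffd, hTint, hfin⟩
    refine isFFD_of_exists_infinite_subset_div_mem T (fun a ha => ?_) (fun x hx s hsD hs => ?_) hfin
    · exact (isIntegral_algHom_iff T.val Subtype.val_injective).mpr (hTint.isIntegral ⟨a, ha⟩)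
    · have hx' : algebraMap R T x ≠ 0 := fun h0 => hx (by
        have := congrArg (algebraMap T K) h0
        rw [← IsScalarTower.algebraMap_apply, map_zero] at this
        simpa using this)
      classical
      -- The value `0` is never taken on divisors of `x`, which come from `R ⊆ T`.
      let φ : K → Associates T := fun y => if hy : y ∈ T then Associates.mk ⟨y, hy⟩ else 0
      have hφ : ∀ y ∈ divisorsIn K x, ∃ hy : y ∈ T, φ y = Associates.mk ⟨y, hy⟩ ∧
          (⟨y, hy⟩ : T) ∣ algebraMap R T x := by
        rintro _ ⟨u, v, huv, rfl⟩
        have hy : algebraMap R K u ∈ T := algebraMap_mem T u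
        refine ⟨hy, dif_pos hy, algebraMap R T v, ?_⟩
        rw [← huv, map_mul]; rfl
      obtain ⟨t, hts, ht, htφ⟩ := hs.exists_infinite_subset_eq_of_finite_image (f := φ)
        ((hTffd.finite_divisors hx').subset (by
          rintro _ ⟨y, hy, rfl⟩
          obtain ⟨_, h1, h2⟩ := hφ y (hsD hy)
          rw [h1]
          exact Associates.mk_dvd_mk.mpr h2))
      refine ⟨t, hts, ht, fun y hy z hz => ?_⟩
      obtain ⟨hyT, hy1, -⟩ := hφ y (hsD (hts hy))
      obtain ⟨hzT, hz1, hz2⟩ := hφ z (hsD (hts hz))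
      have h1 := htφ z hz y hy
      rw [hy1, hz1, Associates.mk_eq_mk_iff_associated] at h1
      obtain ⟨u, hu⟩ := h1
      have hu' : z * ((u : T) : K) = y := congrArg Subtype.val hu
      have hz0 : z ≠ 0 := by
        rintro rfl
        exact hx' (zero_dvd_iff.mp hz2)
      rw [← hu', mul_div_cancel_left₀ _ hz0]
      exact (u : T).2
  tfae_finish
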